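/- Let $m\ge 1$ and let $\lambda_1,\dots,\lambda_m>0$. A seller offers $m$ goods to one buyer with additive valuations, whose value $x_j$ for good $j$ is exponentially distributed with parameter $\lambda_j$, independently across goods (the $\lambda_j$ need not be equal). A mechanism consists of an allocation $a:\mathbb R_+^m\to[0,1]^m$ and a payment $p:\mathbb R_+^m\to\mathbb R_+$; it is individually rational if $a(x)\cdot x-p(x)\ge 0$ for all $x\in\mathbb R_+^m$, and incentive compatible if $a(x)\cdot x-p(x)\ge a(x')\cdot x-p(x')$ for all $x,x'\in\mathbb R_+^m$. Let $\mathrm{Rev}(F)$ denote the supremum of the expected payment $\mathbb E_{x\sim F}[p(x)]$ over all individually rational and incentive compatible mechanisms, and for a product distribution $F=F_1\times\dots\times F_m$ let $\mathrm{SRev}(F)=\sum_{j=1}^m\mathrm{Rev}(F_j)$, the optimal revenue from selling the items separately. Put $$\Gamma(m,w)=\int_w^\infty t^{m-1}e^{-t}\,dt,\qquad g(m,w)=\Gamma(m+1,w)-(m+1)\Gamma(m,w),\qquad G(m)=\int_0^\infty\max\{0,g(m,w)\}\,dw.$$ Then, for $\mathcal E=\mathcal E(\lambda_1)\times\dots\times\mathcal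 E(\lambda_m)$, we have $G(m)>0$, $0<\mathrm{SRev}(\mathcal E)<\infty$, and $$\frac{\mathrm{Rev}(\mathcal E)}{\mathrm{SRev}(\mathcal E)}\le \frac{G(m)}{m!}\,e<e .$$ Equivalently, $\mathrm{SRev}(\mathcal E)\ge \dfrac{1}{e\,G(m)/m!}\,\mathrm{Rev}(\mathcal E)$; in particular $\dfrac{G(m)}{m!}<1$. -/

import Mathlib

open MeasureTheory ProbabilityTheory
open scoped ENNReal Nat

noncomputable section

namespace Monopoly

/-- A direct-revelation selling mechanism for the goods `j : ι` and a buyer with additive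
valuations in the nonnegative orthant `Set.Ici 0`: allocation probabilities `alloc x j ∈ [0, 1]`
(lotteries are allowed) and a payment `payment x ≥ 0` for every reported valuation vector `x`.
Values outside the orthant are irrelevant. -/
structure Mechanism (ι : Type*) where
  alloc : (ι → ℝ) → ι → ℝ
  payment : (ι → ℝ) → ℝ
  alloc_mem : ∀ x ∈ Set.Ici (0 : ι → ℝ), ∀ j, alloc x j ∈ Set.Icc (0 : ℝ) 1
  payment_nonneg : ∀ x ∈ Set.Ici (0 : ι → ℝ), 0 ≤ payment x

variable {ι : Type*} [Fintype ι]

/-- `M.utility x' x` is the utility `u(x' | x)` of a buyer with true valuations `x` who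
reports `x'`. -/
def Mechanism.utility (M : Mechanism ι) (x' x : ι → ℝ) : ℝ :=
  ∑ j, M.alloc x' j * x j - M.payment x'

/-- Individual rationality. -/
def Mechanism.IR (M : Mechanism ι) : Prop :=
  ∀ x ∈ Set.Ici (0 : ι → ℝ), 0 ≤ M.utility x x

/-- Incentive compatibility (truthfulness). -/
def Mechanism.IC (M : Mechanism ι) : Prop :=
  ∀ x ∈ Set.Ici (0 : ι → ℝ), ∀ x' ∈ Set.Ici (0 : ι → ℝ), M.utility x' x ≤ M.utility x x

/-- Expected revenue of a truthfully played mechanism when the valuation vector has law `F` on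
the nonnegative orthant.  (For an IC mechanism and a law `F` that has a density, the payment is
automatically almost everywhere measurable, so no measurability is imposed.) -/
def Mechanism.revenue (M : Mechanism ι) (F : Measure (ι → ℝ)) : ℝ≥0∞ :=
  ∫⁻ x in Set.Ici (0 : ι → ℝ), ENNReal.ofReal (M.payment x) ∂F

/-- `Rev(F)`: the supremum of the expected revenue over all IR and IC mechanisms. -/
def Rev (F : Measure (ι → ℝ)) : ℝ≥0∞ :=
  ⨆ (M : Mechanism ι) (_ : M.IR) (_ : M.IC), M.revenue F

/-- `SRev(F₁ × ⋯ × Fₘ) = Rev(F₁) + ⋯ + Rev(Fₘ)`: optimal revenue from selling every item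
separately.  `Rev(F j)` is the optimal revenue of the one-good problem with value law `F j`. -/
def SRev (F : ι → Measure ℝ) : ℝ≥0∞ :=
  ∑ j, Rev (Measure.pi fun _ : Unit => F j)

/-- Upper incomplete Gamma function `Γ(m, w) = ∫_w^∞ t ^ (m - 1) * exp (-t) dt`, for positive
integers `m`. -/
def upperGamma (m : ℕ) (w : ℝ) : ℝ :=
  ∫ t in Set.Ioi w, t ^ (m - 1) * Real.exp (-t)

/-- `g(m, w) = Γ(m + 1, w) - (m + 1) Γ(m, w)`. -/
def g (m : ℕ) (w : ℝ) : ℝ :=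
  upperGamma (m + 1) w - (m + 1) * upperGamma m w

/-- `G(m) = ∫_0^∞ max {0, g(m, w)} dw`. -/
def G (m : ℕ) : ℝ :=
  ∫ w in Set.Ioi (0 : ℝ), max 0 (g m w)

end Monopoly

end

/-!
The truthful utility `u` of an IC and IR mechanism is convex, and along each axis it increases at a
rate between `0` and `1`. The payment at `x` is at most the derivative of `t ↦ u (t • x)` at `1`
minus `u x`. In polar coordinates the exponential product density restricted to a ray is, up to
scaling, `t ↦ exp (-t)`, and integrating by parts against the incomplete Gamma function turns the
payment collected along the ray into `∫ u' w * g m w`. Since `0 ≤ u' ≤ ∑ j, x j`, this is at most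
`(∑ j, x j) * G m`, whereas the mean of `∑ j, x j` along the same ray is `(∑ j, x j) * m !`. Summing
over the rays gives `Rev ≤ G m / m ! * ∑ j, 1 / lam j`. On the other hand, the posted price
`1 / lam j` alone earns `exp (-1) / lam j` from good `j`. Finally `G m < m !` because
`g m w = w ^ m * exp (-w) - upperGamma m w`.
-/

namespace Monopoly

open Set Filter Topology

section IncompleteGamma

lemma setIntegral_pos_of_forall_pos {α : Type*} [MeasurableSpace α] {μ : Measure α} {s : Set α}
    {f : α → ℝ} (hs : MeasurableSet s) (hμs : μ s ≠ 0) (hf : IntegrableOn f s μ)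
    (hpos : ∀ x ∈ s, 0 < f x) : 0 < ∫ x in s, f x ∂μ := by
  have hsupp : s ⊆ Function.support f ∩ s := fun x hx => ⟨(hpos x hx).ne', hx⟩
  rw [setIntegral_pos_iff_support_of_nonneg_ae
    (ae_restrict_of_forall_mem hs fun x hx => (hpos x hx).le) hf]
  exact (pos_iff_ne_zero.2 hμs).trans_le (measure_mono hsupp)

lemma integrableOn_pow_mul_exp_neg (n : ℕ) (w : ℝ) :
    IntegrableOn (fun t : ℝ => t ^ n * Real.exp (-t)) (Ioi w) := by
  refine integrable_of_isBigO_exp_neg one_half_pos (by fun_prop) ?_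
  simpa only [Real.rpow_natCast, mul_comm] using (Real.Gamma_integrand_isLittleO (n : ℝ)).isBigO

lemma integral_pow_mul_exp_neg (n : ℕ) :
    ∫ t in Ioi (0 : ℝ), t ^ n * Real.exp (-t) = n ! := by
  rw [← Real.Gamma_nat_eq_factorial, Real.Gamma_eq_integral (by positivity)]
  refine setIntegral_congr_fun measurableSet_Ioi fun t _ => ?_
  simp only [add_sub_cancel_right, Real.rpow_natCast, mul_comm]

lemma lintegral_pow_mul_exp_neg (n : ℕ) :
    ∫⁻ t in Ioi (0 : ℝ), ENNReal.ofReal (t ^ n * Real.exp (-t)) = n ! := by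
  rw [← ofReal_integral_eq_lintegral_ofReal (integrableOn_pow_mul_exp_neg n 0),
    integral_pow_mul_exp_neg, ENNReal.ofReal_natCast]
  exact ae_restrict_of_forall_mem measurableSet_Ioi fun t (ht : 0 < t) => by positivity

lemma hasDerivAt_upperGamma (m : ℕ) (w : ℝ) :
    HasDerivAt (upperGamma m) (-(w ^ (m - 1) * Real.exp (-w))) w := by
  have hc : Continuous fun t : ℝ => t ^ (m - 1) * Real.exp (-t) := by fun_prop
  have hint := integrableOn_pow_mul_exp_neg (m - 1)
  have hsub : (fun s => upperGamma m 0 - ∫ t in (0 : ℝ)..s, t ^ (m - 1) * Real.exp (-t)) =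
      upperGamma m := funext fun s => by
    rw [← intervalIntegral.integral_Ioi_sub_Ioi' (hint 0) (hint s), ← upperGamma, ← upperGamma,
      sub_sub_cancel]
  rw [← hsub]
  exact (hc.integral_hasStrictDerivAt 0 w).hasDerivAt.const_sub _

@[fun_prop]
lemma continuous_upperGamma (m : ℕ) : Continuous (upperGamma m) :=
  continuous_iff_continuousAt.2 fun w => (hasDerivAt_upperGamma m w).continuousAt

lemma tendsto_upperGamma (m : ℕ) : Tendsto (upperGamma m) atTop (𝓝 0) :=
  tendsto_integral_Ioi_zero tendsto_id

lemma upperGamma_pos (m : ℕ) {w : ℝ} (hw : 0 ≤ w) : 0 < upperGamma m w :=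
  setIntegral_pos_of_forall_pos measurableSet_Ioi (by simp) (integrableOn_pow_mul_exp_neg _ w)
    fun t ht => by have : 0 < t := hw.trans_lt ht; positivity

lemma mul_upperGamma_lt {m : ℕ} (hm : 0 < m) {w : ℝ} (hw : 0 ≤ w) :
    w * upperGamma m w < upperGamma (m + 1) w := by
  have hint (n : ℕ) := integrableOn_pow_mul_exp_neg n w
  rw [← sub_pos, upperGamma, upperGamma, ← integral_const_mul,
    ← integral_sub (hint _) ((hint _).const_mul w)]
  refine setIntegral_pos_of_forall_pos measurableSet_Ioi (by simp)
    ((hint _).sub ((hint _).const_mul w)) fun t (ht : w < t) => ?_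
  have ht0 : 0 < t := hw.trans_lt ht
  calc 0 < (t - w) * (t ^ (m - 1) * Real.exp (-t)) := mul_pos (sub_pos.2 ht) (by positivity)
    _ = t ^ (m + 1 - 1) * Real.exp (-t) - w * (t ^ (m - 1) * Real.exp (-t)) := by
      rw [Nat.add_sub_cancel, ← pow_sub_one_mul hm.ne' t]
      ring

lemma upperGamma_succ (m : ℕ) (w : ℝ) :
    upperGamma (m + 1) w = m * upperGamma m w + w ^ m * Real.exp (-w) := by
  have hint (n : ℕ) := integrableOn_pow_mul_exp_neg n w
  have hderiv (t : ℝ) : HasDerivAt (fun t : ℝ => -(t ^ m * Real.exp (-t)))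
      (t ^ m * Real.exp (-t) - m * (t ^ (m - 1) * Real.exp (-t))) t :=
    ((hasDerivAt_pow m t).mul (hasDerivAt_neg t).exp).neg.congr_deriv (by ring)
  have hlim : Tendsto (fun t : ℝ => -(t ^ m * Real.exp (-t))) atTop (𝓝 0) := by
    simpa only [neg_zero] using (Real.tendsto_pow_mul_exp_neg_atTop_nhds_zero m).neg
  have hparts := integral_Ioi_of_hasDerivAt_of_tendsto' (fun t (_ : t ∈ Ici w) => hderiv t)
    ((hint m).sub ((hint (m - 1)).const_mul (m : ℝ))) hlim
  rw [integral_sub (hint m) ((hint (m - 1)).const_mul _), integral_const_mul] at hparts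
  rw [upperGamma, upperGamma, Nat.add_sub_cancel]
  linarith

lemma g_eq (m : ℕ) (w : ℝ) :
    g m w = w ^ m * Real.exp (-w) - upperGamma m w := by
  rw [g, upperGamma_succ]
  ring

lemma tendsto_mul_upperGamma {m : ℕ} (hm : 0 < m) :
    Tendsto (fun w => w * upperGamma m w) atTop (𝓝 0) := by
  refine squeeze_zero' ?_ ?_ (tendsto_upperGamma (m + 1))
  · filter_upwards [eventually_ge_atTop 0] with w hw
    exact mul_nonneg hw (upperGamma_pos m hw).le
  · filter_upwards [eventually_ge_atTop 0] with w hw using (mul_upperGamma_lt hm hw).le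

lemma integrableOn_upperGamma {m : ℕ} (hm : 0 < m) : IntegrableOn (upperGamma m) (Ioi 0) := by
  have hderiv (w : ℝ) : HasDerivAt (fun w => w * upperGamma m w - upperGamma (m + 1) w)
      (upperGamma m w) w := by
    refine (((hasDerivAt_id' w).mul (hasDerivAt_upperGamma m w)).sub
      (hasDerivAt_upperGamma (m + 1) w)).congr_deriv ?_
    rw [Nat.add_sub_cancel, ← pow_sub_one_mul hm.ne' w]
    ring
  have hlim := (tendsto_mul_upperGamma hm).sub (tendsto_upperGamma (m + 1))
  exact integrableOn_Ioi_deriv_of_nonneg (by fun_prop) (fun w _ => hderiv w)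
    (fun w (hw : 0 < w) => (upperGamma_pos m hw.le).le) hlim

lemma integrableOn_g {m : ℕ} (hm : 0 < m) : IntegrableOn (g m) (Ioi 0) :=
  (integrableOn_upperGamma m.succ_pos).sub ((integrableOn_upperGamma hm).const_mul _)

lemma integrableOn_max_g {m : ℕ} (hm : 0 < m) :
    IntegrableOn (fun w => max 0 (g m w)) (Ioi 0) :=
  (integrable_zero _ _ _).sup (integrableOn_g hm)

lemma g_pos {m : ℕ} (hm : 0 < m) {w : ℝ} (hw : (m : ℝ) + 1 ≤ w) : 0 < g m w := by
  have hw0 : 0 ≤ w := le_trans (by positivity) hw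
  rw [g, sub_pos]
  exact (mul_le_mul_of_nonneg_right hw (upperGamma_pos m hw0).le).trans_lt
    (mul_upperGamma_lt hm hw0)

lemma G_pos {m : ℕ} (hm : 0 < m) : 0 < G m := by
  have hsub : Ioi ((m : ℝ) + 1) ⊆ Ioi 0 := Ioi_subset_Ioi (by positivity)
  calc 0 < ∫ w in Ioi ((m : ℝ) + 1), max 0 (g m w) :=
        setIntegral_pos_of_forall_pos measurableSet_Ioi (by simp)
          ((integrableOn_max_g hm).mono_set hsub) fun w hw => lt_max_of_lt_right (g_pos hm hw.le)
    _ ≤ G m := setIntegral_mono_set (integrableOn_max_g hm)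
          (Eventually.of_forall fun _ => le_max_left _ _) hsub.eventuallyLE

lemma G_lt_factorial {m : ℕ} (hm : 0 < m) : G m < m ! := by
  have hint := integrableOn_pow_mul_exp_neg m 0
  rw [← integral_pow_mul_exp_neg, ← sub_pos, G, ← integral_sub hint (integrableOn_max_g hm)]
  refine setIntegral_pos_of_forall_pos measurableSet_Ioi (by simp)
    (hint.sub (integrableOn_max_g hm)) fun w (hw : 0 < w) => sub_pos.2 (max_lt (by positivity) ?_)
  rw [g_eq]
  exact sub_lt_self _ (upperGamma_pos m hw.le)

end IncompleteGamma

section BuyerUtility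

/-- `u` is the indirect utility of some individually rational mechanism, where `v x` is the value
of the whole bundle to a buyer of type `x`: `u` is convex and nondecreasing, it grows at most as
fast as `v`, and the buyer of type `0` gains nothing. -/
structure IsBuyerUtility {E : Type*} [AddCommGroup E] [Module ℝ E] [Preorder E]
    (v u : E → ℝ) : Prop where
  convexOn : ConvexOn ℝ univ u
  monotone : Monotone u
  monotone_sub : Monotone fun x => v x - u x
  map_zero : u 0 = 0

/-- The payment `t * u' t - u t` that the envelope formula assigns to type `t` when the buyer's
utility is `u`. The derivative is taken from the right: at a kink this is the largest payment
compatible with `u`. -/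
noncomputable def envelopePayment (u : ℝ → ℝ) (t : ℝ) : ℝ :=
  t * derivWithin u (Ioi t) t - u t

namespace IsBuyerUtility

lemma comp_ray {E : Type*} [AddCommGroup E] [Module ℝ E] [PartialOrder E] [IsOrderedAddMonoid E]
    [SMulPosMono ℝ E] {v u : E → ℝ} (hu : IsBuyerUtility v u) {x : E} (hx : 0 ≤ x) {c : ℝ}
    (hv : ∀ t : ℝ, v (t • x) = c * t) : IsBuyerUtility (c * ·) fun t : ℝ => u (t • x) where
  convexOn := hu.convexOn.comp_linearMap (LinearMap.toSpanSingleton ℝ E x)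
  monotone _ _ hst := hu.monotone (smul_le_smul_of_nonneg_right hst hx)
  monotone_sub s t hst := by
    simpa only [hv] using hu.monotone_sub (smul_le_smul_of_nonneg_right hst hx)
  map_zero := by rw [zero_smul, hu.map_zero]

variable {c : ℝ} {u : ℝ → ℝ} (hu : IsBuyerUtility (c * ·) u) {t : ℝ}
include hu

lemma hasDerivWithinAt (t : ℝ) : HasDerivWithinAt u (derivWithin u (Ioi t) t) (Ioi t) t :=
  hu.convexOn.hasDerivWithinAt_rightDeriv_of_mem_interior (by simp)

lemma continuous : Continuous u := hu.convexOn.locallyLipschitz.continuous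

lemma nonneg (ht : 0 ≤ t) : 0 ≤ u t := hu.map_zero.symm.trans_le (hu.monotone ht)

lemma le_mul (ht : 0 ≤ t) : u t ≤ c * t := by
  simpa only [mul_zero, hu.map_zero, sub_zero, sub_nonneg] using hu.monotone_sub ht

lemma rightDeriv_nonneg (t : ℝ) : 0 ≤ derivWithin u (Ioi t) t :=
  (hu.monotone.monotoneOn _).derivWithin_nonneg

lemma rightDeriv_le (t : ℝ) : derivWithin u (Ioi t) t ≤ c := by
  have hderiv : HasDerivWithinAt (fun s => c * s - u s) (c - derivWithin u (Ioi t) t) (Ioi t) t :=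
    ((hasDerivAt_const_mul c).hasDerivWithinAt).sub (hu.hasDerivWithinAt t)
  rw [← sub_nonneg, ← hderiv.derivWithin (uniqueDiffWithinAt_Ioi t)]
  exact (hu.monotone_sub.monotoneOn _).derivWithin_nonneg

lemma envelopePayment_nonneg (ht : 0 < t) : 0 ≤ envelopePayment u t := by
  have hint : t ∈ interior (univ : Set ℝ) := by simp
  have hslope := (hu.convexOn.slope_le_leftDeriv_of_mem_interior (mem_univ 0) hint ht).trans
    (hu.convexOn.leftDeriv_le_rightDeriv_of_mem_interior hint)
  rw [slope_def_field, hu.map_zero, sub_zero, sub_zero, div_le_iff₀' ht] at hslope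
  exact sub_nonneg.2 hslope

lemma integrableOn_rightDeriv_mul {f : ℝ → ℝ} (hf : IntegrableOn f (Ioi 0)) :
    IntegrableOn (fun t => derivWithin u (Ioi t) t * f t) (Ioi 0) :=
  hf.bdd_mul (measurable_derivWithin_Ioi u).aestronglyMeasurable
    (ae_of_all _ fun t => by
      rw [Real.norm_of_nonneg (hu.rightDeriv_nonneg t)]; exact hu.rightDeriv_le t)

end IsBuyerUtility

lemma integral_Ioi_of_hasDerivWithinAt_Ioi_of_tendsto {f f' : ℝ → ℝ} {a l : ℝ}
    (hcont : ContinuousOn f (Ici a)) (hderiv : ∀ x ∈ Ioi a, HasDerivWithinAt f (f' x) (Ioi x) x)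
    (hint : IntegrableOn f' (Ioi a)) (hlim : Tendsto f atTop (𝓝 l)) :
    ∫ x in Ioi a, f' x = l - f a := by
  refine tendsto_nhds_unique (intervalIntegral_tendsto_integral_Ioi a hint tendsto_id) ?_
  refine (hlim.sub_const (f a)).congr' ?_
  filter_upwards [eventually_ge_atTop a] with b hab
  refine (intervalIntegral.integral_eq_sub_of_hasDeriv_right
    (hcont.mono (by rw [uIcc_of_le hab]; exact Icc_subset_Ici_self)) (fun x hx => ?_) ?_).symm
  · exact hderiv x (by rw [min_eq_left hab] at hx; exact hx.1)
  · exact (intervalIntegrable_iff_integrableOn_Ioc_of_le hab).2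
      (hint.mono_set Ioc_subset_Ioi_self)

namespace IsBuyerUtility

variable {c : ℝ} {u : ℝ → ℝ} (hu : IsBuyerUtility (c * ·) u) {m : ℕ} (hm : 0 < m)
include hu hm

lemma tendsto_mul_upperGamma : Tendsto (fun t => u t * upperGamma m t) atTop (𝓝 0) := by
  have hlim := (Monopoly.tendsto_mul_upperGamma hm).const_mul c
  rw [mul_zero] at hlim
  refine squeeze_zero' ?_ ?_ hlim
  · filter_upwards [eventually_ge_atTop 0] with t ht
    exact mul_nonneg (hu.nonneg ht) (upperGamma_pos m ht).le
  · filter_upwards [eventually_ge_atTop 0] with t ht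
    rw [← mul_assoc]
    exact mul_le_mul_of_nonneg_right (hu.le_mul ht) (upperGamma_pos m ht).le

lemma integrableOn_mul_pow_mul_exp_neg :
    IntegrableOn (fun t => u t * (t ^ (m - 1) * Real.exp (-t))) (Ioi 0) := by
  refine ((integrableOn_pow_mul_exp_neg m 0).const_mul c).mono'
    (by have := hu.continuous; fun_prop) ?_
  refine ae_restrict_of_forall_mem measurableSet_Ioi fun t (ht : 0 < t) => ?_
  have hnonneg := hu.nonneg ht.le
  rw [Real.norm_of_nonneg (by positivity)]
  calc u t * (t ^ (m - 1) * Real.exp (-t))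
      ≤ (c * t) * (t ^ (m - 1) * Real.exp (-t)) :=
        mul_le_mul_of_nonneg_right (hu.le_mul ht.le) (by positivity)
    _ = c * (t ^ m * Real.exp (-t)) := by
        rw [← mul_pow_sub_one hm.ne' t]
        ring

lemma integral_rightDeriv_mul_upperGamma :
    ∫ t in Ioi 0, derivWithin u (Ioi t) t * upperGamma m t =
      ∫ t in Ioi 0, u t * (t ^ (m - 1) * Real.exp (-t)) := by
  have hint := hu.integrableOn_rightDeriv_mul (integrableOn_upperGamma hm)
  have hint' := hu.integrableOn_mul_pow_mul_exp_neg hm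
  have hcont := hu.continuous
  have hderiv (t : ℝ) : HasDerivWithinAt (fun t => u t * upperGamma m t)
      (derivWithin u (Ioi t) t * upperGamma m t - u t * (t ^ (m - 1) * Real.exp (-t)))
      (Ioi t) t :=
    ((hu.hasDerivWithinAt t).mul (hasDerivAt_upperGamma m t).hasDerivWithinAt).congr_deriv
      (by ring)
  rw [← sub_eq_zero, ← integral_sub hint hint', integral_Ioi_of_hasDerivWithinAt_Ioi_of_tendsto
    (by fun_prop) (fun t _ => hderiv t) (hint.sub hint') (hu.tendsto_mul_upperGamma hm),
    hu.map_zero, zero_mul, sub_zero]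

lemma integrableOn_envelopePayment_mul : IntegrableOn
    (fun t => envelopePayment u t * (t ^ (m - 1) * Real.exp (-t))) (Ioi 0) := by
  refine ((hu.integrableOn_rightDeriv_mul (integrableOn_pow_mul_exp_neg m 0)).sub
    (hu.integrableOn_mul_pow_mul_exp_neg hm)).congr_fun (fun t _ => ?_) measurableSet_Ioi
  simp only [Pi.sub_apply, envelopePayment, ← mul_pow_sub_one hm.ne' t]
  ring

lemma integral_envelopePayment_mul_le :
    ∫ t in Ioi 0, envelopePayment u t * (t ^ (m - 1) * Real.exp (-t)) ≤
      c * G m := by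
  have hpow := hu.integrableOn_rightDeriv_mul (integrableOn_pow_mul_exp_neg m 0)
  have hΓ := hu.integrableOn_rightDeriv_mul (integrableOn_upperGamma hm)
  calc ∫ t in Ioi 0, envelopePayment u t * (t ^ (m - 1) * Real.exp (-t))
      = (∫ t in Ioi 0, derivWithin u (Ioi t) t * (t ^ m * Real.exp (-t))) -
          ∫ t in Ioi 0, u t * (t ^ (m - 1) * Real.exp (-t)) := by
        rw [← integral_sub hpow (hu.integrableOn_mul_pow_mul_exp_neg hm)]
        refine setIntegral_congr_fun measurableSet_Ioi fun t _ => ?_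
        simp only [envelopePayment, ← mul_pow_sub_one hm.ne' t]
        ring
    _ = ∫ t in Ioi 0, derivWithin u (Ioi t) t * g m t := by
        simp only [← hu.integral_rightDeriv_mul_upperGamma hm, ← integral_sub hpow hΓ, g_eq,
          mul_sub]
    _ ≤ ∫ t in Ioi 0, c * max 0 (g m t) := by
        refine integral_mono (hu.integrableOn_rightDeriv_mul (integrableOn_g hm))
          ((integrableOn_max_g hm).const_mul c) fun t => ?_
        exact mul_le_mul_of_nonneg (hu.rightDeriv_le t) (le_max_right _ _)
          (hu.rightDeriv_nonneg t) (le_max_left _ _)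
    _ = c * G m := integral_const_mul _ _

lemma lintegral_envelopePayment_mul_le :
    ∫⁻ t in Ioi 0, ENNReal.ofReal (envelopePayment u t * (t ^ (m - 1) * Real.exp (-t))) ≤
      ENNReal.ofReal (c * G m) := by
  rw [← ofReal_integral_eq_lintegral_ofReal (hu.integrableOn_envelopePayment_mul hm)]
  · exact ENNReal.ofReal_le_ofReal (hu.integral_envelopePayment_mul_le hm)
  · refine ae_restrict_of_forall_mem measurableSet_Ioi fun t (ht : 0 < t) => ?_
    exact mul_nonneg (hu.envelopePayment_nonneg ht) (by positivity)

end IsBuyerUtility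

lemma envelopePayment_comp_mul_left (u : ℝ → ℝ) {a : ℝ} (ha : 0 < a) (t : ℝ) :
    envelopePayment (fun s => u (a * s)) t = envelopePayment u (a * t) := by
  rw [envelopePayment, derivWithin_comp_mul_left a u, LinearOrderedField.smul_Ioi ha, smul_eq_mul,
    envelopePayment]
  ring

lemma envelopePayment_smul {E : Type*} [AddCommGroup E] [Module ℝ E] (u : E → ℝ) (x : E)
    {t : ℝ} (ht : 0 < t) :
    envelopePayment (fun s => u (s • t • x)) 1 = envelopePayment (fun s => u (s • x)) t := by
  simpa only [smul_smul, mul_comm t, one_mul] using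
    envelopePayment_comp_mul_left (fun s => u (s • x)) ht 1

lemma measurable_envelopePayment_ray {E : Type*} [NormedAddCommGroup E] [NormedSpace ℝ E]
    [FiniteDimensional ℝ E] [MeasurableSpace E] [BorelSpace E] {u : E → ℝ}
    (hu : ConvexOn ℝ univ u) : Measurable fun x => envelopePayment (fun s => u (s • x)) 1 := by
  have hcont : Continuous u := hu.locallyLipschitz.continuous
  have hseq : Tendsto (fun n : ℕ => (1 : ℝ) + 1 / (n + 1)) atTop (𝓝[>] 1) := by
    refine tendsto_nhdsWithin_iff.2 ⟨?_, Eventually.of_forall fun n => ?_⟩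
    · simpa only [add_zero] using
        (tendsto_one_div_add_atTop_nhds_zero_nat (𝕜 := ℝ)).const_add 1
    · exact lt_add_of_pos_right (1 : ℝ) (by positivity)
  have hlim (x : E) : Tendsto (fun n : ℕ => slope (fun s : ℝ => u (s • x)) 1 (1 + 1 / (n + 1)))
      atTop (𝓝 (derivWithin (fun s : ℝ => u (s • x)) (Ioi 1) 1)) :=
    ((hasDerivWithinAt_iff_tendsto_slope' self_notMem_Ioi).1
      ((hu.comp_linearMap (LinearMap.toSpanSingleton ℝ E x)
        ).hasDerivWithinAt_rightDeriv_of_mem_interior (by simp))).comp hseq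
  have hderiv : Measurable fun x => derivWithin (fun s : ℝ => u (s • x)) (Ioi 1) 1 := by
    refine measurable_of_tendsto_metrizable (fun n => ?_) (tendsto_pi_nhds.2 hlim)
    simp only [slope_def_field]
    fun_prop
  simp only [envelopePayment, one_mul, one_smul]
  exact hderiv.sub hcont.measurable

end BuyerUtility

section Mechanism

variable {ι : Type*} [Fintype ι] {M : Mechanism ι}

namespace Mechanism

/-- The utility of a buyer with valuations `x` who chooses the best report. For an incentive
compatible mechanism and `x ≥ 0` this is the truthful utility, but as a supremum of affine functions
it is convex on the whole space, whatever the mechanism. -/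
noncomputable def indirectUtility (M : Mechanism ι) (x : ι → ℝ) : ℝ :=
  ⨆ r : Ici (0 : ι → ℝ), M.utility r x

lemma utility_le_sum_abs (M : Mechanism ι) {r : ι → ℝ} (hr : r ∈ Ici 0) (x : ι → ℝ) :
    M.utility r x ≤ ∑ j, |x j| := by
  refine (sub_le_self _ (M.payment_nonneg r hr)).trans (Finset.sum_le_sum fun j _ => ?_)
  obtain ⟨halloc0, halloc1⟩ := M.alloc_mem r hr j
  exact (mul_le_mul_of_nonneg_left (le_abs_self _) halloc0).trans
    (mul_le_of_le_one_left (abs_nonneg _) halloc1)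

lemma utility_le_indirectUtility (M : Mechanism ι) {r : ι → ℝ} (hr : r ∈ Ici 0) (x : ι → ℝ) :
    M.utility r x ≤ M.indirectUtility x :=
  le_ciSup (f := fun r : Ici (0 : ι → ℝ) => M.utility r x)
    ⟨∑ j, |x j|, forall_mem_range.2 fun r => M.utility_le_sum_abs r.2 x⟩ ⟨r, hr⟩

lemma indirectUtility_le {x : ι → ℝ} {b : ℝ} (h : ∀ r ∈ Ici 0, M.utility r x ≤ b) :
    M.indirectUtility x ≤ b :=
  ciSup_le fun r => h r r.2

lemma utility_sub_utility (M : Mechanism ι) (r x y : ι → ℝ) :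
    M.utility r y - M.utility r x = ∑ j, M.alloc r j * (y j - x j) := by
  simp only [utility, mul_sub, Finset.sum_sub_distrib]
  ring

lemma utility_mono (M : Mechanism ι) {r : ι → ℝ} (hr : r ∈ Ici 0) :
    Monotone (M.utility r) := fun x y hxy => by
  rw [← sub_nonneg, utility_sub_utility]
  exact Finset.sum_nonneg fun j _ => mul_nonneg (M.alloc_mem r hr j).1 (sub_nonneg.2 (hxy j))

lemma monotone_sum_sub_utility (M : Mechanism ι) {r : ι → ℝ} (hr : r ∈ Ici 0) :
    Monotone fun x => ∑ j, x j - M.utility r x := fun x y hxy => by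
  have hgain : M.utility r y - M.utility r x ≤ ∑ j, (y j - x j) := by
    rw [utility_sub_utility]
    exact Finset.sum_le_sum fun j _ =>
      mul_le_of_le_one_left (sub_nonneg.2 (hxy j)) (M.alloc_mem r hr j).2
  rw [Finset.sum_sub_distrib] at hgain
  linarith

lemma convexOn_indirectUtility (M : Mechanism ι) : ConvexOn ℝ univ M.indirectUtility := by
  refine ⟨convex_univ, fun x _ y _ a b ha hb hab => indirectUtility_le fun r hr => ?_⟩
  have haffine : M.utility r (a • x + b • y) = a • M.utility r x + b • M.utility r y := by
    simp only [utility, Pi.add_apply, Pi.smul_apply, smul_eq_mul, mul_sub, Finset.mul_sum, mul_add,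
      mul_left_comm _ a, mul_left_comm _ b, Finset.sum_add_distrib]
    linear_combination M.payment r * hab
  rw [haffine]
  exact add_le_add (smul_le_smul_of_nonneg_left (M.utility_le_indirectUtility hr x) ha)
    (smul_le_smul_of_nonneg_left (M.utility_le_indirectUtility hr y) hb)

lemma IC.indirectUtility_eq (hIC : M.IC) {x : ι → ℝ} (hx : x ∈ Ici 0) :
    M.indirectUtility x = M.utility x x :=
  le_antisymm (indirectUtility_le fun r hr => hIC x hx r hr) (M.utility_le_indirectUtility hx x)

lemma IR.isBuyerUtility_indirectUtility (hIR : M.IR) :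
    IsBuyerUtility (fun x => ∑ j, x j) M.indirectUtility where
  convexOn := M.convexOn_indirectUtility
  monotone _ y hxy := indirectUtility_le fun _ hr =>
    (M.utility_mono hr hxy).trans (M.utility_le_indirectUtility hr y)
  monotone_sub x y hxy := by
    refine le_sub_comm.1 (indirectUtility_le fun r hr => ?_)
    linarith [M.monotone_sum_sub_utility hr hxy, M.utility_le_indirectUtility hr x]
  map_zero := le_antisymm
    (indirectUtility_le fun r hr => by simpa using M.utility_le_sum_abs hr 0)
    ((hIR 0 self_mem_Ici).trans (M.utility_le_indirectUtility self_mem_Ici 0))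

lemma IC.payment_le_envelopePayment (hIC : M.IC) {x : ι → ℝ} (hx : x ∈ Ici 0) :
    M.payment x ≤ envelopePayment (fun s => M.indirectUtility (s • x)) 1 := by
  have hslope : ∀ᶠ s in 𝓝[>] (1 : ℝ),
      ∑ j, M.alloc x j * x j ≤ slope (fun s => M.indirectUtility (s • x)) 1 s := by
    filter_upwards [self_mem_nhdsWithin] with s (hs : 1 < s)
    have hgain : M.utility x (s • x) - M.utility x x = (∑ j, M.alloc x j * x j) * (s - 1) := by
      rw [utility_sub_utility, Finset.sum_mul]
      exact Finset.sum_congr rfl fun j _ => by rw [Pi.smul_apply, smul_eq_mul]; ring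
    rw [slope_def_field, one_smul, hIC.indirectUtility_eq hx, le_div_iff₀ (sub_pos.2 hs), ← hgain]
    exact sub_le_sub_right (M.utility_le_indirectUtility hx _) _
  have hderiv := (M.convexOn_indirectUtility.comp_linearMap
    (LinearMap.toSpanSingleton ℝ _ x)).hasDerivWithinAt_rightDeriv_of_mem_interior
    (x := (1 : ℝ)) (by simp)
  have hle := ge_of_tendsto ((hasDerivWithinAt_iff_tendsto_slope' self_notMem_Ioi).1 hderiv) hslope
  rw [envelopePayment, one_smul, hIC.indirectUtility_eq hx, one_mul]
  calc M.payment x = ∑ j, M.alloc x j * x j - M.utility x x := (sub_sub_cancel _ _).symm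
    _ ≤ _ := sub_le_sub_right hle _

end Mechanism

end Mechanism

section PolarCoordinates

lemma lintegral_Ioi_eq_mul_lintegral_comp_mul {b : ℝ} (hb : 0 < b) (f : ℝ → ℝ≥0∞) :
    ∫⁻ t in Ioi 0, f t = ENNReal.ofReal b * ∫⁻ t in Ioi 0, f (b * t) := by
  have hsubst := lintegral_image_eq_lintegral_abs_deriv_mul measurableSet_Ioi
    (fun t (_ : t ∈ Ioi (0 : ℝ)) => (hasDerivAt_const_mul b).hasDerivWithinAt)
    (mul_right_injective₀ hb.ne').injOn f
  rwa [image_const_mul_Ioi_zero hb, abs_of_pos hb,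
    lintegral_const_mul' _ _ ENNReal.ofReal_ne_top] at hsubst

/-- The integral of `F` along the open ray through `x` against `r ^ k dr`. For `x` in the unit
sphere and `k + 1` the dimension, this is the inner integral in polar coordinates. -/
noncomputable def rayLIntegral {E : Type*} [AddCommGroup E] [Module ℝ E] (k : ℕ) (F : E → ℝ≥0∞)
    (x : E) : ℝ≥0∞ :=
  ∫⁻ r in Ioi (0 : ℝ), ENNReal.ofReal (r ^ k) * F (r • x)

section Module

variable {E : Type*} [AddCommGroup E] [Module ℝ E] (k : ℕ) (F : E → ℝ≥0∞)

lemma rayLIntegral_eq_mul_rayLIntegral_smul (x : E) {b : ℝ} (hb : 0 < b) :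
    rayLIntegral k F x = ENNReal.ofReal (b ^ (k + 1)) * rayLIntegral k F (b • x) := by
  rw [rayLIntegral, rayLIntegral, lintegral_Ioi_eq_mul_lintegral_comp_mul hb, pow_succ',
    ENNReal.ofReal_mul hb.le, mul_assoc, ← lintegral_const_mul' (ENNReal.ofReal (b ^ k)) _
    ENNReal.ofReal_ne_top]
  congr 1
  refine lintegral_congr fun r => ?_
  rw [mul_pow, ENNReal.ofReal_mul (by positivity), smul_smul, mul_assoc, mul_comm r b]

lemma rayLIntegral_indicator {S : Set E} (hcone : ∀ x ∈ S, ∀ r : ℝ, 0 < r → r • x ∈ S) :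
    rayLIntegral k (S.indicator F) = S.indicator (rayLIntegral k F) := by
  have hmem {r : ℝ} (hr : 0 < r) (x : E) : r • x ∈ S ↔ x ∈ S :=
    ⟨fun h => inv_smul_smul₀ hr.ne' x ▸ hcone _ h _ (inv_pos.2 hr), fun h => hcone _ h _ hr⟩
  funext x
  by_cases hx : x ∈ S
  · rw [indicator_of_mem hx]
    refine setLIntegral_congr_fun measurableSet_Ioi fun r hr => ?_
    simp only [indicator_of_mem ((hmem hr x).2 hx)]
  · rw [indicator_of_notMem hx]
    refine setLIntegral_eq_zero measurableSet_Ioi fun r hr => ?_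
    simp only [indicator_of_notMem (mt (hmem hr x).1 hx), mul_zero, Pi.zero_apply]

end Module

variable {E : Type*} [NormedAddCommGroup E] [NormedSpace ℝ E] [MeasurableSpace E] [BorelSpace E]
  [FiniteDimensional ℝ E] [Nontrivial E] (μ : Measure E) [μ.IsAddHaarMeasure]

lemma lintegral_eq_lintegral_rayLIntegral {F : E → ℝ≥0∞} (hF : Measurable F) :
    ∫⁻ x, F x ∂μ = ∫⁻ θ, rayLIntegral (Module.finrank ℝ E - 1) F θ ∂μ.toSphere := by
  have hF' : Measurable fun p : Metric.sphere (0 : E) 1 × Ioi (0 : ℝ) =>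
      F ((p.2 : ℝ) • (p.1 : E)) := by fun_prop
  calc ∫⁻ x, F x ∂μ = ∫⁻ x : ({(0)}ᶜ : Set E), F x ∂(μ.comap (↑)) := by
        rw [lintegral_subtype_comap (measurableSet_singleton _).compl, restrict_compl_singleton]
    _ = ∫⁻ p, F ((p.2 : ℝ) • (p.1 : E))
          ∂μ.toSphere.prod (.volumeIoiPow (Module.finrank ℝ E - 1)) := by
        rw [← μ.measurePreserving_homeomorphUnitSphereProd.lintegral_comp hF']
        refine lintegral_congr fun x => ?_
        rw [← homeomorphUnitSphereProd_symm_apply_coe, Homeomorph.symm_apply_apply]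
    _ = ∫⁻ θ, ∫⁻ r, F ((r : ℝ) • (θ : E)) ∂.volumeIoiPow (Module.finrank ℝ E - 1) ∂μ.toSphere :=
        lintegral_prod _ hF'.aemeasurable
    _ = ∫⁻ θ, rayLIntegral (Module.finrank ℝ E - 1) F θ ∂μ.toSphere := by
        refine lintegral_congr fun θ => ?_
        rw [Measure.volumeIoiPow, lintegral_withDensity_eq_lintegral_mul _ (by fun_prop)
          (by fun_prop), rayLIntegral, ← lintegral_subtype_comap measurableSet_Ioi]
        rfl

lemma setLIntegral_le_of_rayLIntegral_le {S : Set E} (hS : MeasurableSet S)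
    (hcone : ∀ x ∈ S, ∀ r : ℝ, 0 < r → r • x ∈ S) {F H : E → ℝ≥0∞} (hF : Measurable F)
    (hH : Measurable H)
    (hray : ∀ x ∈ S, x ≠ 0 → ∃ b : ℝ, 0 < b ∧ rayLIntegral (Module.finrank ℝ E - 1) F (b • x) ≤
      rayLIntegral (Module.finrank ℝ E - 1) H (b • x)) :
    ∫⁻ x in S, F x ∂μ ≤ ∫⁻ x in S, H x ∂μ := by
  rw [← lintegral_indicator hS, ← lintegral_indicator hS,
    lintegral_eq_lintegral_rayLIntegral μ (hF.indicator hS),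
    lintegral_eq_lintegral_rayLIntegral μ (hH.indicator hS)]
  refine lintegral_mono fun θ => ?_
  rw [rayLIntegral_indicator _ _ hcone, rayLIntegral_indicator _ _ hcone]
  by_cases hθ : (θ : E) ∈ S
  · obtain ⟨b, hb, hle⟩ := hray θ hθ (ne_zero_of_mem_unit_sphere θ)
    rw [indicator_of_mem hθ, indicator_of_mem hθ, rayLIntegral_eq_mul_rayLIntegral_smul _ F _ hb,
      rayLIntegral_eq_mul_rayLIntegral_smul _ H _ hb]
    gcongr
  · rw [indicator_of_notMem hθ, indicator_of_notMem hθ]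

end PolarCoordinates

section RadiallyExponential

/-- Along every ray of the nonnegative orthant the density `f` is a multiple of a decaying
exponential. For such densities revenue can be bounded ray by ray. -/
def RadiallyExponential {ι : Type*} (f : (ι → ℝ) → ℝ≥0∞) : Prop :=
  ∀ x ∈ Ici 0, x ≠ 0 → ∃ (c : NNReal) (b : ℝ), 0 < b ∧
    ∀ t : ℝ, 0 < t → f (t • x) = c * ENNReal.ofReal (Real.exp (-(b * t)))

section Ray

variable {E : Type*} [AddCommGroup E] [Module ℝ E] {f : E → ℝ≥0∞} {x : E} {c : NNReal}
  (hf : ∀ t : ℝ, 0 < t → f (t • x) = c * ENNReal.ofReal (Real.exp (-t))) {v : E → ℝ} {a : ℝ}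
  (hv : ∀ t : ℝ, v (t • x) = a * t) {m : ℕ} (hm : 0 < m)
include hf hv hm

lemma rayLIntegral_mul_envelopePayment_le [PartialOrder E] [IsOrderedAddMonoid E]
    [SMulPosMono ℝ E] {u : E → ℝ} (hu : IsBuyerUtility v u) (hx : 0 ≤ x) :
    rayLIntegral (m - 1)
        (fun z => f z * ENNReal.ofReal (envelopePayment (fun s => u (s • z)) 1)) x ≤
      c * ENNReal.ofReal (a * G m) := by
  calc _ = ∫⁻ t in Ioi 0, c * ENNReal.ofReal
          (envelopePayment (fun s => u (s • x)) t * (t ^ (m - 1) * Real.exp (-t))) := by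
        refine setLIntegral_congr_fun measurableSet_Ioi fun t (ht : 0 < t) => ?_
        simp only [hf t ht, envelopePayment_smul u x ht]
        rw [ENNReal.ofReal_mul' (by positivity), ENNReal.ofReal_mul (by positivity)]
        ring
    _ ≤ c * ENNReal.ofReal (a * G m) := by
        rw [lintegral_const_mul' _ _ ENNReal.coe_ne_top]
        gcongr
        exact (hu.comp_ray hx hv).lintegral_envelopePayment_mul_le hm

lemma rayLIntegral_mul_ofReal (ha : 0 ≤ a) :
    rayLIntegral (m - 1) (fun z => f z * ENNReal.ofReal (v z)) x =
      c * ENNReal.ofReal (a * m !) := by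
  calc _ = ∫⁻ t in Ioi 0, c * ENNReal.ofReal a * ENNReal.ofReal (t ^ m * Real.exp (-t)) := by
        refine setLIntegral_congr_fun measurableSet_Ioi fun t (ht : 0 < t) => ?_
        simp only [hf t ht, hv]
        rw [ENNReal.ofReal_mul ha, ENNReal.ofReal_mul (by positivity), ← pow_sub_one_mul hm.ne',
          ENNReal.ofReal_mul (by positivity)]
        ring
    _ = c * ENNReal.ofReal (a * m !) := by
        rw [lintegral_const_mul' _ _ (by finiteness), lintegral_pow_mul_exp_neg,
          ENNReal.ofReal_mul ha, ENNReal.ofReal_natCast, mul_assoc]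

end Ray

variable {ι : Type*} [Fintype ι] [Nonempty ι]

lemma Mechanism.revenue_le_of_radiallyExponential {M : Mechanism ι} (hIR : M.IR) (hIC : M.IC)
    {f : (ι → ℝ) → ℝ≥0∞} (hfm : Measurable f) (hf : RadiallyExponential f) :
    M.revenue (volume.withDensity f) ≤ ∫⁻ x in Ici 0,
      ENNReal.ofReal (G (Fintype.card ι) / (Fintype.card ι)! * ∑ j, x j)
        ∂volume.withDensity f := by
  have hm : 0 < Fintype.card ι := Fintype.card_pos
  have hG := (G_pos hm).le
  have hP := (measurable_envelopePayment_ray M.convexOn_indirectUtility).ennreal_ofReal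
  have hS : Measurable fun x : ι → ℝ =>
    ENNReal.ofReal (G (Fintype.card ι) / (Fintype.card ι)! * ∑ j, x j) := by fun_prop
  refine (setLIntegral_mono' measurableSet_Ici fun x hx =>
    ENNReal.ofReal_le_ofReal (hIC.payment_le_envelopePayment hx)).trans ?_
  rw [setLIntegral_withDensity_eq_setLIntegral_mul _ hfm hP measurableSet_Ici,
    setLIntegral_withDensity_eq_setLIntegral_mul _ hfm hS measurableSet_Ici]
  refine setLIntegral_le_of_rayLIntegral_le volume measurableSet_Ici
    (fun x hx r hr => smul_nonneg hr.le hx) (hfm.mul hP) (hfm.mul hS) fun x hx hx0 => ?_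
  obtain ⟨c, b, hb, hexp⟩ := hf x hx hx0
  have hy : 0 ≤ b⁻¹ • x := smul_nonneg (inv_pos.2 hb).le hx
  have hfy (t : ℝ) (ht : 0 < t) : f (t • b⁻¹ • x) = c * ENNReal.ofReal (Real.exp (-t)) := by
    rw [smul_smul, hexp _ (mul_pos ht (inv_pos.2 hb)), mul_comm t, mul_inv_cancel_left₀ hb.ne']
  have hsum (t : ℝ) : ∑ j, (t • b⁻¹ • x) j = (∑ j, (b⁻¹ • x) j) * t := by
    simp only [Pi.smul_apply, smul_eq_mul, ← Finset.mul_sum, mul_comm]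
  refine ⟨b⁻¹, inv_pos.2 hb, ?_⟩
  rw [Module.finrank_fintype_fun_eq_card]
  calc _ ≤ c * ENNReal.ofReal ((∑ j, (b⁻¹ • x) j) * G (Fintype.card ι)) :=
        rayLIntegral_mul_envelopePayment_le hfy hsum hm hIR.isBuyerUtility_indirectUtility hy
    _ = c * ENNReal.ofReal (G (Fintype.card ι) / (Fintype.card ι)! * (∑ j, (b⁻¹ • x) j) *
          (Fintype.card ι)!) := by
        congr 2
        field_simp
    _ = _ := (rayLIntegral_mul_ofReal hfy (fun t => by rw [hsum, mul_assoc]) hm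
        (mul_nonneg (by positivity) (Finset.sum_nonneg fun j _ => hy j))).symm

lemma Rev_withDensity_le {f : (ι → ℝ) → ℝ≥0∞} (hfm : Measurable f) (hf : RadiallyExponential f) :
    Rev (volume.withDensity f) ≤ ENNReal.ofReal (G (Fintype.card ι) / (Fintype.card ι)!) *
      ∫⁻ x in Ici 0, ENNReal.ofReal (∑ j, x j) ∂volume.withDensity f := by
  have hG := (G_pos (Fintype.card_pos (α := ι))).le
  rw [← lintegral_const_mul' _ _ ENNReal.ofReal_ne_top]
  simp only [← ENNReal.ofReal_mul (div_nonneg hG (Nat.cast_nonneg _))]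
  exact iSup_le fun M => iSup₂_le fun hIR hIC =>
    Mechanism.revenue_le_of_radiallyExponential hIR hIC hfm hf

end RadiallyExponential

section ExponentialLaws

lemma lintegral_pi_prod {ι : Type*} [Fintype ι] {α : ι → Type*} [∀ i, MeasurableSpace (α i)]
    (μ : ∀ i, Measure (α i)) [∀ i, SigmaFinite (μ i)] {f : ∀ i, α i → ℝ≥0∞}
    (hf : ∀ i, Measurable (f i)) :
    ∫⁻ x, ∏ i, f i (x i) ∂Measure.pi μ = ∏ i, ∫⁻ a, f i a ∂μ i := by
  classical
  have hmarginal (s : Finset ι) :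
      ∫⋯∫⁻_s, (fun x => ∏ i ∈ s, f i (x i)) ∂μ = fun _ => ∏ i ∈ s, ∫⁻ a, f i a ∂μ i := by
    induction s using Finset.induction_on with
    | empty => simp
    | insert i s hi ih =>
      have hupdate (x : ∀ i, α i) : ∫⁻ a, ∏ j ∈ insert i s, f j (Function.update x i a j) ∂μ i =
          (∫⁻ a, f i a ∂μ i) * ∏ j ∈ s, f j (x j) := by
        rw [← lintegral_mul_const _ (hf i)]
        refine lintegral_congr fun a => ?_
        rw [Finset.prod_insert hi, Function.update_self]
        congr 1
        exact Finset.prod_congr rfl fun j hj => by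
          rw [Function.update_of_ne (ne_of_mem_of_not_mem hj hi)]
      funext x
      rw [lmarginal_insert' _ (by fun_prop) hi, Finset.prod_insert hi, ← congrFun ih x]
      simp only [hupdate, lmarginal]
      exact lintegral_const_mul _ <| Finset.measurable_prod _ fun j _ =>
        (hf j).comp ((measurable_pi_apply j).comp measurable_updateFinset)
  rcases isEmpty_or_nonempty (∀ i, α i) with hα | ⟨⟨x⟩⟩
  · obtain ⟨i, hi⟩ := isEmpty_pi.1 hα
    rw [lintegral_of_isEmpty, Finset.prod_eq_zero (Finset.mem_univ i) (lintegral_of_isEmpty _ _)]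
  · rw [lintegral_eq_lmarginal_univ x, hmarginal]

lemma pi_withDensity {ι : Type*} [Fintype ι] {α : ι → Type*} [∀ i, MeasurableSpace (α i)]
    (μ : ∀ i, Measure (α i)) [∀ i, SigmaFinite (μ i)] {f : ∀ i, α i → ℝ≥0∞}
    (hf : ∀ i, Measurable (f i)) [∀ i, SigmaFinite ((μ i).withDensity (f i))] :
    Measure.pi (fun i => (μ i).withDensity (f i)) =
      (Measure.pi μ).withDensity fun x => ∏ i, f i (x i) := by
  refine Measure.pi_eq fun s hs => ?_
  rw [withDensity_apply _ (MeasurableSet.univ_pi hs), Measure.restrict_pi_pi,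
    lintegral_pi_prod _ hf]
  exact Finset.prod_congr rfl fun i _ => (withDensity_apply _ (hs i)).symm

lemma measurable_exponentialPDF (r : ℝ) : Measurable (exponentialPDF r) :=
  (measurable_exponentialPDFReal r).ennreal_ofReal

lemma expMeasure_Ioi {r t : ℝ} (hr : 0 < r) (ht : 0 ≤ t) :
    expMeasure r (Ioi t) = ENNReal.ofReal (Real.exp (-(r * t))) := by
  have := isProbabilityMeasure_expMeasure hr
  have hcdf : (expMeasure r).real (Iic t) = 1 - Real.exp (-(r * t)) := by
    rw [← cdf_eq_real, cdf_expMeasure_eq hr, if_pos ht]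
  rw [← compl_Iic, ← ofReal_measureReal (measure_ne_top _ _),
    probReal_compl_eq_one_sub measurableSet_Iic, hcdf, sub_sub_cancel]

lemma lintegral_ofReal_expMeasure {r : ℝ} (hr : 0 < r) :
    ∫⁻ x, ENNReal.ofReal x ∂expMeasure r = ENNReal.ofReal (1 / r) := by
  calc ∫⁻ x, ENNReal.ofReal x ∂expMeasure r
      = ∫⁻ x, ENNReal.ofReal (max x 0) ∂expMeasure r := by
        simp only [ENNReal.ofReal_max, ENNReal.ofReal_zero, max_eq_left zero_le]
    _ = ∫⁻ t in Ioi 0, expMeasure r {x | t < max x 0} :=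
        lintegral_eq_lintegral_meas_lt _ (ae_of_all _ fun x => le_max_right x 0) (by fun_prop)
    _ = ∫⁻ t in Ioi 0, ENNReal.ofReal (Real.exp (-(r * t))) := by
        refine setLIntegral_congr_fun measurableSet_Ioi fun t (ht : 0 < t) => ?_
        rw [← expMeasure_Ioi hr ht.le]
        congr 1
        ext x
        simp [ht.not_gt]
    _ = ENNReal.ofReal (1 / r) := by
        rw [lintegral_Ioi_eq_mul_lintegral_comp_mul (one_div_pos.2 hr)]
        simp only [← mul_assoc, mul_one_div_cancel hr.ne', one_mul]
        simpa using congrArg (ENNReal.ofReal (1 / r) * ·) (lintegral_pow_mul_exp_neg 0)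

variable {ι : Type*} [Fintype ι] {lam : ι → ℝ} (hlam : ∀ j, 0 < lam j)
include hlam

lemma pi_expMeasure :
    Measure.pi (fun j => expMeasure (lam j)) =
      volume.withDensity fun x => ∏ j, exponentialPDF (lam j) (x j) :=
  have (j : ι) : SigmaFinite (volume.withDensity (exponentialPDF (lam j))) :=
    have := isProbabilityMeasure_expMeasure (hlam j)
    inferInstanceAs (SigmaFinite (expMeasure (lam j)))
  pi_withDensity (f := fun j => exponentialPDF (lam j)) _ fun j =>
    measurable_exponentialPDF (lam j)

lemma prod_exponentialPDF {x : ι → ℝ} (hx : 0 ≤ x) :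
    ∏ j, exponentialPDF (lam j) (x j) =
      ENNReal.ofReal ((∏ j, lam j) * Real.exp (-∑ j, lam j * x j)) := by
  rw [← Finset.sum_neg_distrib, Real.exp_sum, ← Finset.prod_mul_distrib,
    ENNReal.ofReal_prod_of_nonneg fun j _ => mul_nonneg (hlam j).le (Real.exp_pos _).le]
  exact Finset.prod_congr rfl fun j _ => exponentialPDF_of_nonneg (hx j)

lemma radiallyExponential_prod_exponentialPDF :
    RadiallyExponential fun x => ∏ j, exponentialPDF (lam j) (x j) := by
  intro x hx hx0
  obtain ⟨i, hi⟩ := Function.ne_iff.1 hx0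
  refine ⟨(∏ j, lam j).toNNReal, ∑ j, lam j * x j, ?_, fun t ht => ?_⟩
  · exact Finset.sum_pos' (fun j _ => mul_nonneg (hlam j).le (hx j))
      ⟨i, Finset.mem_univ i, mul_pos (hlam i) (lt_of_le_of_ne (hx i) hi.symm)⟩
  · change ∏ j, exponentialPDF (lam j) ((t • x) j) = _
    rw [prod_exponentialPDF hlam (smul_nonneg ht.le hx),
      ENNReal.ofReal_mul (Finset.prod_nonneg fun j _ => (hlam j).le)]
    simp only [Pi.smul_apply, smul_eq_mul, Finset.sum_mul]
    congr 4
    exact Finset.sum_congr rfl fun j _ => by ring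

lemma lintegral_sum_pi_expMeasure_le :
    ∫⁻ x in Ici 0, ENNReal.ofReal (∑ j, x j) ∂Measure.pi (fun j => expMeasure (lam j)) ≤
      ∑ j, ENNReal.ofReal (1 / lam j) := by
  have (j : ι) : IsProbabilityMeasure (expMeasure (lam j)) :=
    isProbabilityMeasure_expMeasure (hlam j)
  calc _ = ∫⁻ x in Ici 0, ∑ j, ENNReal.ofReal (x j) ∂Measure.pi fun j => expMeasure (lam j) :=
        setLIntegral_congr_fun measurableSet_Ici fun x hx =>
          ENNReal.ofReal_sum_of_nonneg fun j _ => hx j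
    _ ≤ ∫⁻ x, ∑ j, ENNReal.ofReal (x j) ∂Measure.pi fun j => expMeasure (lam j) :=
        setLIntegral_le_lintegral _ _
    _ = ∑ j, ENNReal.ofReal (1 / lam j) := by
        rw [lintegral_finsetSum _ fun j _ => by fun_prop]
        refine Finset.sum_congr rfl fun j _ => ?_
        rw [← lintegral_ofReal_expMeasure (hlam j)]
        exact (measurePreserving_eval (fun j => expMeasure (lam j)) j).lintegral_comp
          ENNReal.measurable_ofReal

lemma Rev_pi_expMeasure_le [Nonempty ι] :
    Rev (Measure.pi fun j => expMeasure (lam j)) ≤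
      ENNReal.ofReal (G (Fintype.card ι) / (Fintype.card ι)!) *
        ∑ j, ENNReal.ofReal (1 / lam j) := by
  refine le_trans ?_ (mul_le_mul_right (lintegral_sum_pi_expMeasure_le hlam) _)
  rw [pi_expMeasure hlam]
  exact Rev_withDensity_le
    (Finset.measurable_prod _ fun j _ =>
      (measurable_exponentialPDF (lam j)).comp (measurable_pi_apply j))
    (radiallyExponential_prod_exponentialPDF hlam)

end ExponentialLaws

section PostedPrice

open Classical in
/-- The mechanism that sells a single good at the posted price `p`; an indifferent buyer buys. -/
noncomputable def postedPrice (p : ℝ) (hp : 0 ≤ p) : Mechanism Unit where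
  alloc x _ := if p ≤ x () then 1 else 0
  payment x := if p ≤ x () then p else 0
  alloc_mem x _ _ := by split_ifs <;> simp
  payment_nonneg x _ := by split_ifs <;> simp [hp]

lemma postedPrice_utility {p : ℝ} (hp : 0 ≤ p) (x' x : Unit → ℝ) :
    (postedPrice p hp).utility x' x = if p ≤ x' () then x () - p else 0 := by
  simp only [Mechanism.utility, postedPrice, Finset.univ_unique, PUnit.default_eq_unit]
  split_ifs <;> simp

lemma postedPrice_IR {p : ℝ} (hp : 0 ≤ p) : (postedPrice p hp).IR := by
  intro x _
  rw [postedPrice_utility]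
  split_ifs with hbuy
  · exact sub_nonneg.2 hbuy
  · exact le_rfl

lemma postedPrice_IC {p : ℝ} (hp : 0 ≤ p) : (postedPrice p hp).IC := by
  intro x _ x' _
  rw [postedPrice_utility, postedPrice_utility]
  split_ifs <;> linarith

lemma ofReal_mul_measure_Ioi_le_Rev (μ : Measure ℝ) [SigmaFinite μ] {p : ℝ} (hp : 0 ≤ p) :
    ENNReal.ofReal p * μ (Ioi p) ≤ Rev (Measure.pi fun _ : Unit => μ) := by
  have hsub : univ.pi (fun _ : Unit => Ioi p) ⊆ Ici 0 := fun x hx j =>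
    hp.trans (le_of_lt (hx j trivial))
  calc _ = ∫⁻ _ in univ.pi (fun _ : Unit => Ioi p), ENNReal.ofReal p
          ∂Measure.pi fun _ : Unit => μ := by
        simp only [setLIntegral_const, Measure.pi_pi, Finset.univ_unique, Finset.prod_singleton]
    _ ≤ ∫⁻ x in univ.pi (fun _ : Unit => Ioi p), ENNReal.ofReal ((postedPrice p hp).payment x)
          ∂Measure.pi fun _ : Unit => μ := by
        refine setLIntegral_mono' (MeasurableSet.univ_pi fun _ => measurableSet_Ioi) fun x hx => ?_
        have hbuy : p ≤ x () := le_of_lt (hx () trivial)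
        simp only [postedPrice, if_pos hbuy, le_refl]
    _ ≤ (postedPrice p hp).revenue (Measure.pi fun _ : Unit => μ) := lintegral_mono_set hsub
    _ ≤ _ := by
        refine le_iSup_of_le (postedPrice p hp) ?_
        exact le_iSup₂_of_le (postedPrice_IR hp) (postedPrice_IC hp) le_rfl

variable {ι : Type*} [Fintype ι] {lam : ι → ℝ} (hlam : ∀ j, 0 < lam j)
include hlam

lemma sum_mul_exp_neg_one_le_SRev :
    (∑ j, ENNReal.ofReal (1 / lam j)) * ENNReal.ofReal (Real.exp (-1)) ≤
      SRev fun j => expMeasure (lam j) := by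
  rw [Finset.sum_mul]
  refine Finset.sum_le_sum fun j _ => ?_
  have := isProbabilityMeasure_expMeasure (hlam j)
  have hprice : 0 ≤ 1 / lam j := (one_div_pos.2 (hlam j)).le
  have hsale := ofReal_mul_measure_Ioi_le_Rev (expMeasure (lam j)) hprice
  rwa [expMeasure_Ioi (hlam j) hprice, mul_one_div_cancel (hlam j).ne'] at hsale

lemma SRev_expMeasure_pos [Nonempty ι] : 0 < SRev fun j => expMeasure (lam j) := by
  inhabit ι
  refine (ENNReal.mul_pos ?_ ?_).trans_le (sum_mul_exp_neg_one_le_SRev hlam)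
  · rw [Ne, Finset.sum_eq_zero_iff]
    exact fun hzero =>
      (ENNReal.ofReal_pos.2 (one_div_pos.2 (hlam default))).ne' (hzero _ (Finset.mem_univ default))
  · exact (ENNReal.ofReal_pos.2 (Real.exp_pos _)).ne'

lemma SRev_expMeasure_lt_top : SRev (fun j => expMeasure (lam j)) < ∞ :=
  ENNReal.sum_lt_top.2 fun j _ =>
    (Rev_pi_expMeasure_le fun _ : Unit => hlam j).trans_lt
      (ENNReal.mul_lt_top ENNReal.ofReal_lt_top
        (ENNReal.sum_lt_top.2 fun _ _ => ENNReal.ofReal_lt_top))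

lemma Rev_le_mul_SRev [Nonempty ι] :
    Rev (Measure.pi fun j => expMeasure (lam j)) ≤
      ENNReal.ofReal (G (Fintype.card ι) / (Fintype.card ι)! * Real.exp 1) *
        SRev fun j => expMeasure (lam j) := by
  have hG := (G_pos (Fintype.card_pos (α := ι))).le
  calc _ ≤ ENNReal.ofReal (G (Fintype.card ι) / (Fintype.card ι)!) *
          ∑ j, ENNReal.ofReal (1 / lam j) := Rev_pi_expMeasure_le hlam
    _ = ENNReal.ofReal (G (Fintype.card ι) / (Fintype.card ι)! * Real.exp 1) *
          ((∑ j, ENNReal.ofReal (1 / lam j)) * ENNReal.ofReal (Real.exp (-1))) := by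
        have hexp : ENNReal.ofReal (Real.exp 1) * ENNReal.ofReal (Real.exp (-1)) = 1 := by
          rw [← ENNReal.ofReal_mul (Real.exp_pos 1).le, ← Real.exp_add, add_neg_cancel,
            Real.exp_zero, ENNReal.ofReal_one]
        rw [ENNReal.ofReal_mul (by positivity), mul_mul_mul_comm, hexp, mul_one]
    _ ≤ _ := mul_le_mul_right (sum_mul_exp_neg_one_le_SRev hlam) _

end PostedPrice

end Monopoly

theorem mainTheorem5_general {ι : Type*} [Fintype ι] [Nonempty ι] {lam : ι → ℝ}
    (hlam : ∀ j, 0 < lam j) :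
    0 < Monopoly.G (Fintype.card ι) ∧
    0 < Monopoly.SRev (fun j => expMeasure (lam j)) ∧
    Monopoly.SRev (fun j => expMeasure (lam j)) < ⊤ ∧
    Monopoly.Rev (Measure.pi fun j => expMeasure (lam j)) /
        Monopoly.SRev (fun j => expMeasure (lam j)) ≤
      ENNReal.ofReal (Monopoly.G (Fintype.card ι) / ((Fintype.card ι)! : ℝ) * Real.exp 1) ∧
    ENNReal.ofReal
          (1 / (Real.exp 1 * (Monopoly.G (Fintype.card ι) / ((Fintype.card ι)! : ℝ)))) *
        Monopoly.Rev (Measure.pi fun j => expMeasure (lam j)) ≤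
      Monopoly.SRev (fun j => expMeasure (lam j)) ∧
    Monopoly.G (Fintype.card ι) / ((Fintype.card ι)! : ℝ) < 1 ∧
    Monopoly.G (Fintype.card ι) / ((Fintype.card ι)! : ℝ) * Real.exp 1 < Real.exp 1 := by
  have hm : 0 < Fintype.card ι := Fintype.card_pos
  have hG := Monopoly.G_pos hm
  have hratio : Monopoly.G (Fintype.card ι) / ((Fintype.card ι)! : ℝ) < 1 :=
    (div_lt_one (by positivity)).2 (Monopoly.G_lt_factorial hm)
  have hRev := Monopoly.Rev_le_mul_SRev hlam
  refine ⟨hG, Monopoly.SRev_expMeasure_pos hlam, Monopoly.SRev_expMeasure_lt_top hlam,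
    ENNReal.div_le_of_le_mul hRev, ?_, hratio, mul_lt_of_lt_one_left (Real.exp_pos 1) hratio⟩
  refine (mul_le_mul_right hRev _).trans_eq ?_
  rw [← mul_assoc, ← ENNReal.ofReal_mul (by positivity), mul_comm (Real.exp 1),
    one_div_mul_cancel (by positivity), ENNReal.ofReal_one, one_mul]

theorem mainTheorem5 (m : ℕ) (hm : 0 < m) (lam : Fin m → ℝ) (hlam : ∀ j, 0 < lam j) :
    0 < Monopoly.G m ∧
    0 < Monopoly.SRev (fun j => expMeasure (lam j)) ∧
    Monopoly.SRev (fun j => expMeasure (lam j)) < ⊤ ∧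
    Monopoly.Rev (Measure.pi fun j => expMeasure (lam j)) /
        Monopoly.SRev (fun j => expMeasure (lam j)) ≤
      ENNReal.ofReal (Monopoly.G m / (m ! : ℝ) * Real.exp 1) ∧
    ENNReal.ofReal (1 / (Real.exp 1 * (Monopoly.G m / (m ! : ℝ)))) *
        Monopoly.Rev (Measure.pi fun j => expMeasure (lam j)) ≤
      Monopoly.SRev (fun j => expMeasure (lam j)) ∧
    Monopoly.G m / (m ! : ℝ) < 1 ∧
    Monopoly.G m / (m ! : ℝ) * Real.exp 1 < Real.exp 1 := by
  have : Nonempty (Fin m) := Fin.pos_iff_nonempty.1 hm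
  simpa only [Fintype.card_fin] using mainTheorem5_general hlam
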